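/- For $n\ge 1$, a *standard $n$-puzzle* is a $2\times(n+1)$ array whose set of entries is exactly $\{1,2,\dots,2n+2\}$. Its *pieces* are the $n$ squares formed by two adjacent columns; the *reduction* of a piece is obtained by replacing its four labels by $1,2,3,4$ in the same relative order. For a set $\mathcal P$ of reduced pieces let $s_n(\mathcal P)$ be the number of standard $n$-puzzles all of whose pieces have their reduction in $\mathcal P$. Put $$A_2=\begin{bmatrix}3&4\\1&2\end{bmatrix},\quad A_3=\begin{bmatrix}2&4\\1&3\end{bmatrix},\quad \mathcal P=\{A_2,A_3\},$$ $$B_1=\begin{bmatrix}4&2\\1&3\end{bmatrix},\; B_2=\begin{bmatrix}3&2\\1&4\end{bmatrix},\; B_3=\begin{bmatrix}2&3\\1&4\end{bmatrix},\; B_4=\begin{bmatrix}3&1\\2&4\end{bmatrix},\; B_5=\begin{bmatrix}4&1\\2&3\end{bmatrix},\; B_6=\begin{bmatrix}4&1\\3&2\end{bmatrix}.$$ Let $C(n)=\frac1{n+2}\binom{2n+2}{n+1}$ (the Catalan numbers, indexed so that $C(0)=1$, $C(1)=2$, $C(2)=5$), and let $t(n,k)$, $0\le k\le n$, be Catalan's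 triangle: $t(0,0)=1$ and $t(n,k)=\sum_{j=0}^{k}t(n-1,j)$ for $n\ge1$, with $t(n-1,n)=0$. **Theorem.** For every $n\ge1$: - $s_n(\mathcal P\cup \{B_1\})=\dfrac{3}{n+3}\dbinom{2n+2}{n}$; - $s_n(\mathcal P\cup \{B_2\})=\dfrac{7n+2}{n^2+2n}\dbinom{2n}{n+1}$; - $s_n(\mathcal P\cup \{B_3\})=C(n)+C(n-1)$; - $s_n(\mathcal P\cup \{B_4\})=\dbinom{2n+1}{n}$; - $s_n(\mathcal P\cup \{B_5\})=\dfrac{8n(2n+1)}{(n+2)(n+3)}\dbinom{2n-1}{n}+\dfrac{2}{n+2}\dbinom{2n+2}{n+1}-\dbinom{2n+1}{n}$; - $s_n(\mathcal P\cup \{B_6\})=\dfrac{3\binom{2n-1}{n}\binom{2n+2}{3}}{(n+2)(n+3)}+\dfrac{1}{n+2}\dbinom{2n+2}{n+1}$. Moreover, as sums against Catalan's triangle, - $s_n(\mathcal P\cup \{B_1\})=\sum_{k=1}^{n-1}\binom{n-k+3}{3}t(n-2,k-1)+C(n)$ for $n\ge2$; - $s_n(\mathcal P\cup \{B_2\})=\sum_{k=1}^{n-1}\binom{n-k+2}{2}t(n-2,k-1)+C(n)$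 for $n\ge2$; - $s_n(\mathcal P\cup \{B_4\})=\sum_{k=1}^{n}(n+k-1)\,t(n-1,k-1)+C(n)$ for $n\ge1$; - $s_n(\mathcal P\cup \{B_5\})=\sum_{k=1}^{n}(n+k-1)(n-k+2)\,t(n-1,k-1)-\binom{2n+1}{n}+2C(n)$ for $n\ge1$; - $s_n(\mathcal P\cup \{B_6\})=\sum_{k=1}^{n}\binom{n+k}{2}t(n-1,k-1)+C(n)$ for $n\ge1$. -/

import Mathlib

namespace StandardPuzzle

/-- A `2 × (n + 1)` array (row `0` is the top row, row `1` the bottom row), that is, a row of `n`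
concatenated pieces, is a standard `n`-puzzle if the set of its labels is `{1, …, 2n + 2}`, where
`2n + 2` is the number of its vertices. -/
def IsStandardPuzzle (n : ℕ) (M : Matrix (Fin 2) (Fin (n + 1)) ℕ) : Prop :=
  Set.range (fun v : Fin 2 × Fin (n + 1) => M v.1 v.2) = Set.Icc 1 (2 * n + 2)

/-- The `k`-th piece of a puzzle: the square formed by two adjacent columns. -/
def pieceAt {n : ℕ} (M : Matrix (Fin 2) (Fin (n + 1)) ℕ) (k : Fin n) : Matrix (Fin 2) (Fin 2) ℕ :=
  !![M 0 k.castSucc, M 0 k.succ;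
     M 1 k.castSucc, M 1 k.succ]

/-- The reduction of a piece: every label is replaced by its rank among the labels of the piece,
so that four distinct labels become `1, 2, 3, 4` in the same relative order. -/
def reduction (p : Matrix (Fin 2) (Fin 2) ℕ) : Matrix (Fin 2) (Fin 2) ℕ :=
  fun i j => (Finset.univ.filter (fun v : Fin 2 × Fin 2 => p v.1 v.2 ≤ p i j)).card

/-- `P` is a support of the puzzle `M` if the reduction of each piece of `M` belongs to `P`. -/
def IsSupport {n : ℕ} (P : Set (Matrix (Fin 2) (Fin 2) ℕ))
    (M : Matrix (Fin 2) (Fin (n + 1)) ℕ) : Prop :=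
  ∀ k : Fin n, reduction (pieceAt M k) ∈ P

/-- The set `S_n(P)` of the standard `n`-puzzles with support `P`. -/
def S (n : ℕ) (P : Set (Matrix (Fin 2) (Fin 2) ℕ)) : Set (Matrix (Fin 2) (Fin (n + 1)) ℕ) :=
  {M | IsStandardPuzzle n M ∧ IsSupport P M}

/-- The number `s_n(P)` of standard `n`-puzzles with support `P`. -/
noncomputable def s (n : ℕ) (P : Set (Matrix (Fin 2) (Fin 2) ℕ)) : ℕ := (S n P).ncard

def A₂ : Matrix (Fin 2) (Fin 2) ℕ := !![3, 4; 1, 2]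
def A₃ : Matrix (Fin 2) (Fin 2) ℕ := !![2, 4; 1, 3]

def B₁ : Matrix (Fin 2) (Fin 2) ℕ := !![4, 2; 1, 3]
def B₂ : Matrix (Fin 2) (Fin 2) ℕ := !![3, 2; 1, 4]
def B₃ : Matrix (Fin 2) (Fin 2) ℕ := !![2, 3; 1, 4]
def B₄ : Matrix (Fin 2) (Fin 2) ℕ := !![3, 1; 2, 4]
def B₅ : Matrix (Fin 2) (Fin 2) ℕ := !![4, 1; 2, 3]
def B₆ : Matrix (Fin 2) (Fin 2) ℕ := !![4, 1; 3, 2]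

/-- Catalan's triangle `t(n, k)`, `0 ≤ k ≤ n`, extended by `0` to `k > n`. -/
def t : ℕ → ℕ → ℕ
  | 0, k => if k = 0 then 1 else 0
  | n + 1, k => if k ≤ n + 1 then ∑ j ∈ Finset.range (k + 1), t n j else 0

end StandardPuzzle

namespace StandardPuzzle

open Finset

/-! Every piece of `{A₂, A₃, Bᵢ}` has an increasing left column (bottom below top), and only `Bᵢ`
has a decreasing right column. Hence `Bᵢ` can occur only as the last piece: a puzzle is a two-rowed
standard Young tableau followed by one more column.

The top right label of a tableau is its maximum, so the ways to append a column depend only on the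
bottom right label `x`. Appending another tableau column replaces `x` by any larger admissible
bottom label. This is the partial-sum recursion of `t`, whence `t m k` tableaux have `x = m + 1 + k`
(`ncard_tableaux`). The admissible last columns are then counted: pieces `A₂`, `A₃` contribute a
Catalan number, and `Bᵢ` contributes a row sum of `t` weighted by a polynomial in `k` (`s_succ_eq`).

Since `t` is built by partial sums, weighting a row by `(m - k + r).choose r` gives a single entry
of a later row (`sum_choose_mul_t`). Each weight is a combination of these with `r ≤ 2`, and the
ballot formula (`succ_mul_t`) yields the closed forms. -/

/-! ### Catalan's triangle and the ballot formula -/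

theorem t_succ_eq_sum {n k : ℕ} (h : k ≤ n + 1) : t (n + 1) k = ∑ j ∈ range (k + 1), t n j := by
  rw [t, if_pos h]

theorem t_eq_zero {n k : ℕ} (h : n < k) : t n k = 0 := by
  cases n with
  | zero => rw [t, if_neg (by omega)]
  | succ n => rw [t, if_neg (by omega)]

theorem t_succ_succ {n k : ℕ} (h : k ≤ n) : t (n + 1) (k + 1) = t (n + 1) k + t n (k + 1) := by
  rw [t_succ_eq_sum (by omega), t_succ_eq_sum (by omega), sum_range_succ _ (k + 1)]

theorem t_diag (n : ℕ) : t (n + 1) (n + 1) = t (n + 1) n := by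
  rw [t_succ_succ le_rfl, t_eq_zero (n.lt_succ_self), add_zero]

/-- Induction along the Pascal-like recursion. The range includes `k = n + 1`, where both sides
vanish, because the step next to the diagonal uses that entry. -/
theorem succ_mul_t (n k : ℕ) (h : k ≤ n + 1) :
    ((n : ℚ) + 1) * t n k = (n + 1 - k) * (n + k).choose k := by
  induction n generalizing k with
  | zero => interval_cases k <;> simp [t]
  | succ n ihn =>
    induction k with
    | zero =>
      have := ihn 0 (by omega)
      simp only [t_succ_eq_sum (Nat.zero_le (n + 1))]
      have h0 : ((n : ℚ) + 1) ≠ 0 := by positivity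
      have h1 : (t n 0 : ℚ) = 1 := mul_left_cancel₀ h0 (by simpa using this)
      simp [h1]
    | succ k ihk =>
      rcases (show k ≤ n ∨ k = n + 1 by omega) with hk | rfl
      · have h1 := ihk (by omega)
        have h2 := ihn (k + 1) (by omega)
        rw [t_succ_succ hk]
        have hp : (n + 1 + (k + 1)).choose (k + 1)
            = (n + 1 + k).choose k + (n + 1 + k).choose (k + 1) :=
          Nat.choose_succ_succ (n + 1 + k) k
        have hq : (n + 1 + k).choose (k + 1) * (k + 1) = (n + 1 + k).choose k * (n + 1) := by
          rw [Nat.choose_succ_right_eq]; congr 1; omega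
        have hq' : ((n + 1 + k).choose (k + 1) : ℚ) * (k + 1)
            = (n + 1 + k).choose k * (n + 1) := by exact_mod_cast hq
        rw [show n + (k + 1) = n + 1 + k by ring] at h2
        rw [hp]
        push_cast at h1 h2 ⊢
        -- The two induction hypotheses carry the factors `n + 2` and `n + 1`; multiplying the goal
        -- by `n + 1` makes it a combination of both.
        have h0 : ((n : ℚ) + 1) ≠ 0 := by positivity
        apply mul_left_cancel₀ h0
        linear_combination (n + 1 : ℚ) * h1 + (n + 2 : ℚ) * h2 - hq'
      · rw [t_eq_zero (by omega)]
        push_cast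
        ring

theorem t_add_eq (m r : ℕ) :
    (t (m + r) m : ℚ) =
      (r + 1) / (m + r + 1) * ((2 * m + r).factorial / (m.factorial * (m + r).factorial)) := by
  have h := succ_mul_t (m + r) m (by omega)
  rw [show m + r + m = m + (m + r) by ring, Nat.cast_add_choose ℚ,
    show m + (m + r) = 2 * m + r by ring] at h
  have h0 : ((m : ℚ) + r + 1) ≠ 0 := by positivity
  rw [div_mul_eq_mul_div, eq_div_iff h0]
  push_cast at h
  linear_combination h

theorem t_diag_eq_catalan (n : ℕ) : t (n + 1) n = catalan (n + 1) := by
  have h := t_add_eq (n + 1) 0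
  rw [← t_diag]
  have hc : ((n + 1 + 1 : ℕ) : ℚ) * catalan (n + 1) = (n + 1).centralBinom := by
    exact_mod_cast succ_mul_catalan_eq_centralBinom (n + 1)
  rw [Nat.centralBinom, show 2 * (n + 1) = (n + 1) + (n + 1) by ring, Nat.cast_add_choose ℚ] at hc
  have h0 : ((n : ℚ) + 2) ≠ 0 := by positivity
  have : (t (n + 1) (n + 1) : ℚ) = catalan (n + 1) := by
    apply mul_left_cancel₀ h0
    push_cast at hc
    rw [show (n : ℚ) + 2 = n + 1 + 1 by ring, hc]
    simp only [add_zero] at h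
    rw [h, show 2 * (n + 1) = (n + 1) + (n + 1) by ring]
    push_cast
    have : ((n : ℚ) + 1 + 1) ≠ 0 := by positivity
    field_simp
    ring
  exact_mod_cast this

/-! ### Binomially weighted row sums of Catalan's triangle -/

/-- The hockey-stick identity expands each binomial, and exchanging the sums trades one degree of
the weight for one partial summation of `f`. -/
theorem sum_choose_mul_eq_sum_choose_mul_sum (M r : ℕ) (f : ℕ → ℕ) :
    ∑ j ∈ range (M + 1), (M - j + (r + 1)).choose (r + 1) * f j =
      ∑ i ∈ range (M + 1), (M - i + r).choose r * ∑ j ∈ range (i + 1), f j := by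
  have key : ∀ j ∈ range (M + 1), (M - j + (r + 1)).choose (r + 1) * f j =
      ∑ i ∈ Ico j (M + 1), (M - i + r).choose r * f j := by
    intro j hj
    rw [mem_range] at hj
    rw [← sum_mul, sum_Ico_eq_sum_range, ← sum_range_reflect, ← add_assoc,
      ← Nat.sum_range_add_choose, show M + 1 - j = M - j + 1 by omega]
    congr 1
    refine sum_congr rfl fun i hi => ?_
    rw [mem_range] at hi
    congr 1
    omega
  rw [sum_congr rfl key, range_eq_Ico, sum_Ico_Ico_comm]
  refine sum_congr rfl fun i _ => ?_
  rw [range_eq_Ico, mul_sum]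

theorem sum_choose_mul_t (m r : ℕ) :
    ∑ j ∈ range (m + 1), (m - j + r).choose r * t m j = t (m + r + 1) m := by
  -- The row is freed from the column bound `m`, since each step of the induction on `r` moves one
  -- row down.
  suffices h : ∀ n, m ≤ n →
      ∑ j ∈ range (m + 1), (m - j + r).choose r * t n j = t (n + r + 1) m from h m le_rfl
  induction r with
  | zero =>
    intro n hn
    simp [t_succ_eq_sum (show m ≤ n + 1 by omega)]
  | succ r ih =>
    intro n hn
    rw [sum_choose_mul_eq_sum_choose_mul_sum, show n + (r + 1) + 1 = (n + 1) + r + 1 by ring,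
      ← ih (n + 1) (by omega)]
    refine sum_congr rfl fun i hi => ?_
    rw [mem_range] at hi
    rw [t_succ_eq_sum (by omega)]

/-- Starting one row higher costs one more degree in the weight; this gives the sums over row `n -
2`. -/
theorem sum_choose_mul_t_pred (m r : ℕ) :
    ∑ j ∈ range (m + 1), (m + 1 - j + (r + 1)).choose (r + 1) * t m j =
      t (m + 1 + r + 1) (m + 1) := by
  have h := sum_choose_mul_eq_sum_choose_mul_sum (m + 1) r (t m)
  rw [sum_range_succ, t_eq_zero (m.lt_succ_self), mul_zero, add_zero] at h
  rw [h, ← sum_choose_mul_t]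
  refine sum_congr rfl fun i hi => ?_
  rw [mem_range] at hi
  rw [t_succ_eq_sum (by omega)]

/-! ### Standard puzzles and the insertion of a last column -/

/-- The increasing bijection from the positive integers onto those different from `lo < hi`. -/
def gapMap (lo hi v : ℕ) : ℕ := if v < lo then v else if v + 1 < hi then v + 1 else v + 2

/-- Append to `M` a last column with bottom label `b` and top label `c`, shifting the labels of `M`
so as to make room for `b` and `c`. -/
def appendColumn {n : ℕ} (M : Matrix (Fin 2) (Fin (n + 1)) ℕ) (b c : ℕ) :
    Matrix (Fin 2) (Fin (n + 2)) ℕ :=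
  fun i => Fin.snoc (α := fun _ => ℕ) (fun j => gapMap (min b c) (max b c) (M i j)) (![c, b] i)

/-- The puzzles with support `{A₂, A₃}` whose last column increases. -/
def tableaux (n : ℕ) : Set (Matrix (Fin 2) (Fin (n + 1)) ℕ) :=
  {M | IsStandardPuzzle n M ∧ IsSupport {A₂, A₃} M ∧ M 1 (Fin.last n) < M 0 (Fin.last n)}

theorem gapMap_strictMono {lo hi : ℕ} (_ : lo < hi) : StrictMono (gapMap lo hi) := by
  intro a b hab
  unfold gapMap
  split_ifs <;> omega

theorem exists_gapMap_eq {lo hi w N : ℕ} (_ : lo < hi) (hlo : 1 ≤ lo) (hhi : hi ≤ N + 2)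
    (hw1 : 1 ≤ w) (hwN : w ≤ N + 2) (h1 : w ≠ lo) (h2 : w ≠ hi) :
    ∃ v, (1 ≤ v ∧ v ≤ N) ∧ gapMap lo hi v = w := by
  refine ⟨if w < lo then w else if w < hi then w - 1 else w - 2, ?_, ?_⟩
  · split_ifs <;> omega
  · unfold gapMap
    split_ifs <;> omega

section appendColumn

variable {n : ℕ} (M : Matrix (Fin 2) (Fin (n + 1)) ℕ) (b c : ℕ)

@[simp] theorem appendColumn_castSucc (i : Fin 2) (j : Fin (n + 1)) :
    appendColumn M b c i j.castSucc = gapMap (min b c) (max b c) (M i j) := by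
  simp [appendColumn]

@[simp] theorem appendColumn_last (i : Fin 2) :
    appendColumn M b c i (Fin.last (n + 1)) = ![c, b] i := by
  simp [appendColumn]

theorem pieceAt_appendColumn_castSucc (k : Fin n) :
    pieceAt (appendColumn M b c) k.castSucc =
      (pieceAt M k).map (gapMap (min b c) (max b c)) := by
  ext i j
  fin_cases i <;> fin_cases j <;> simp [pieceAt, Fin.succ_castSucc, -Fin.castSucc_succ]

theorem pieceAt_appendColumn_last :
    pieceAt (appendColumn M b c) (Fin.last n) =
      !![gapMap (min b c) (max b c) (M 0 (Fin.last n)), c;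
        gapMap (min b c) (max b c) (M 1 (Fin.last n)), b] := by
  simp [pieceAt]

end appendColumn

theorem reduction_map {f : ℕ → ℕ} (hf : StrictMono f) (p : Matrix (Fin 2) (Fin 2) ℕ) :
    reduction (p.map f) = reduction p := by
  ext i j
  simp [reduction, hf.le_iff_le]

/-- Relabelling is strictly monotone, so the old pieces keep their reductions and only the new piece
must be tested. -/
theorem isSupport_appendColumn {n : ℕ} (P : Set (Matrix (Fin 2) (Fin 2) ℕ))
    (M : Matrix (Fin 2) (Fin (n + 1)) ℕ) {b c : ℕ} (hbc : b ≠ c) :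
    IsSupport P (appendColumn M b c) ↔ IsSupport P M ∧
      reduction !![gapMap (min b c) (max b c) (M 0 (Fin.last n)), c;
        gapMap (min b c) (max b c) (M 1 (Fin.last n)), b] ∈ P := by
  have hlt : min b c < max b c := by omega
  simp only [IsSupport, Fin.forall_fin_succ', pieceAt_appendColumn_castSucc,
    pieceAt_appendColumn_last, reduction_map (gapMap_strictMono hlt)]

theorem IsStandardPuzzle.mem {n : ℕ} {M : Matrix (Fin 2) (Fin (n + 1)) ℕ}
    (h : IsStandardPuzzle n M) (i : Fin 2) (j : Fin (n + 1)) :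
    1 ≤ M i j ∧ M i j ≤ 2 * n + 2 := by
  have : M i j ∈ Set.Icc 1 (2 * n + 2) := h ▸ ⟨(i, j), rfl⟩
  simpa using this

theorem IsStandardPuzzle.exists_eq {n : ℕ} {M : Matrix (Fin 2) (Fin (n + 1)) ℕ}
    (h : IsStandardPuzzle n M) {v : ℕ} (h1 : 1 ≤ v) (h2 : v ≤ 2 * n + 2) :
    ∃ i j, M i j = v := by
  have : v ∈ Set.range (fun v : Fin 2 × Fin (n + 1) => M v.1 v.2) := by
    rw [show Set.range _ = _ from h]
    exact ⟨h1, h2⟩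
  obtain ⟨⟨i, j⟩, hij⟩ := this
  exact ⟨i, j, hij⟩

theorem isStandardPuzzle_of {n : ℕ} {M : Matrix (Fin 2) (Fin (n + 1)) ℕ}
    (h1 : ∀ i j, 1 ≤ M i j ∧ M i j ≤ 2 * n + 2)
    (h2 : ∀ v, 1 ≤ v → v ≤ 2 * n + 2 → ∃ i j, M i j = v) : IsStandardPuzzle n M := by
  ext v
  constructor
  · rintro ⟨⟨i, j⟩, rfl⟩
    exact h1 i j
  · rintro ⟨ha, hb⟩
    obtain ⟨i, j, rfl⟩ := h2 v ha hb
    exact ⟨(i, j), rfl⟩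

/-- There are as many cells as labels, so surjectivity onto the labels forces injectivity. -/
theorem IsStandardPuzzle.injective {n : ℕ} {M : Matrix (Fin 2) (Fin (n + 1)) ℕ}
    (h : IsStandardPuzzle n M) :
    Function.Injective (fun v : Fin 2 × Fin (n + 1) => M v.1 v.2) := by
  have himage : univ.image (fun v : Fin 2 × Fin (n + 1) => M v.1 v.2) = Icc 1 (2 * n + 2) := by
    rw [← Finset.coe_inj, Finset.coe_image, Finset.coe_univ, Set.image_univ, Finset.coe_Icc]
    exact h
  have hinj : Set.InjOn (fun v : Fin 2 × Fin (n + 1) => M v.1 v.2)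
      (univ : Finset (Fin 2 × Fin (n + 1))) :=
    Finset.card_image_iff.1 (by rw [himage]; simp; ring)
  rwa [Finset.coe_univ, Set.injOn_univ] at hinj

theorem IsStandardPuzzle.eq_of_eq {n : ℕ} {M : Matrix (Fin 2) (Fin (n + 1)) ℕ}
    (h : IsStandardPuzzle n M) {i i' : Fin 2} {j j' : Fin (n + 1)} (he : M i j = M i' j') :
    i = i' ∧ j = j' := by
  have := @IsStandardPuzzle.injective n M h (i, j) (i', j') he
  simpa using this

theorem finite_isStandardPuzzle (n : ℕ) : {M | IsStandardPuzzle n M}.Finite :=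
  (Set.Finite.pi' fun _ => Set.Finite.pi' fun _ => Set.finite_Icc 1 (2 * n + 2)).subset
    fun _ hM i j => hM.mem i j

theorem isStandardPuzzle_appendColumn {n : ℕ} {M : Matrix (Fin 2) (Fin (n + 1)) ℕ}
    (hM : IsStandardPuzzle n M) {b c : ℕ} (hbc : b ≠ c) (hb1 : 1 ≤ b) (hb : b ≤ 2 * n + 4)
    (hc1 : 1 ≤ c) (hc : c ≤ 2 * n + 4) : IsStandardPuzzle (n + 1) (appendColumn M b c) := by
  refine isStandardPuzzle_of (fun i j => ?_) fun v h1 h2 => ?_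
  · induction j using Fin.lastCases with
    | last => fin_cases i <;> simp <;> omega
    | cast j =>
      have := hM.mem i j
      simp only [appendColumn_castSucc, gapMap]
      split_ifs <;> omega
  · by_cases hvb : v = b
    · exact ⟨1, Fin.last _, by simp [hvb]⟩
    by_cases hvc : v = c
    · exact ⟨0, Fin.last _, by simp [hvc]⟩
    obtain ⟨w, ⟨hw1, hw2⟩, hw⟩ := exists_gapMap_eq (lo := min b c) (hi := max b c) (w := v)
      (N := 2 * n + 2) (by omega) (by omega) (by omega) h1 (by omega) (by omega) (by omega)
    obtain ⟨i, j, rfl⟩ := hM.exists_eq hw1 hw2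
    exact ⟨i, j.castSucc, by simp [hw]⟩

theorem IsStandardPuzzle.exists_appendColumn {n : ℕ} {M : Matrix (Fin 2) (Fin (n + 2)) ℕ}
    (hM : IsStandardPuzzle (n + 1) M) : ∃ (M' : Matrix (Fin 2) (Fin (n + 1)) ℕ) (b c : ℕ),
      IsStandardPuzzle n M' ∧ b ≠ c ∧ (1 ≤ b ∧ b ≤ 2 * n + 4) ∧ (1 ≤ c ∧ c ≤ 2 * n + 4) ∧
        appendColumn M' b c = M := by
  obtain ⟨b, hbdef⟩ : ∃ b, M 1 (Fin.last (n + 1)) = b := ⟨_, rfl⟩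
  obtain ⟨c, hcdef⟩ : ∃ c, M 0 (Fin.last (n + 1)) = c := ⟨_, rfl⟩
  have hb : 1 ≤ b ∧ b ≤ 2 * n + 4 := hbdef ▸ hM.mem 1 (Fin.last _)
  have hc : 1 ≤ c ∧ c ≤ 2 * n + 4 := hcdef ▸ hM.mem 0 (Fin.last _)
  have hbc : b ≠ c := by
    intro h
    have := hM.eq_of_eq (hbdef.trans (h.trans hcdef.symm))
    simp at this
  have hlt : min b c < max b c := by omega
  have key : ∀ i (j : Fin (n + 1)), ∃ v, (1 ≤ v ∧ v ≤ 2 * n + 2) ∧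
      gapMap (min b c) (max b c) v = M i j.castSucc := by
    intro i j
    have h1 : M i j.castSucc ≠ b := fun h =>
      (Fin.castSucc_lt_last j).ne (hM.eq_of_eq (h.trans hbdef.symm)).2
    have h2 : M i j.castSucc ≠ c := fun h =>
      (Fin.castSucc_lt_last j).ne (hM.eq_of_eq (h.trans hcdef.symm)).2
    have := hM.mem i j.castSucc
    exact exists_gapMap_eq hlt (by omega) (by omega) (by omega) (by omega) (by omega) (by omega)
  obtain ⟨M', hM'⟩ : ∃ M' : Matrix (Fin 2) (Fin (n + 1)) ℕ, ∀ i j,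
      (1 ≤ M' i j ∧ M' i j ≤ 2 * n + 2) ∧
        gapMap (min b c) (max b c) (M' i j) = M i j.castSucc := by
    choose f hf using key
    exact ⟨f, hf⟩
  refine ⟨M', b, c, isStandardPuzzle_of (fun i j => (hM' i j).1) fun v h1 h2 => ?_, hbc, hb, hc, ?_⟩
  · have hv : 1 ≤ gapMap (min b c) (max b c) v ∧ gapMap (min b c) (max b c) v ≤ 2 * n + 4 ∧
        gapMap (min b c) (max b c) v ≠ b ∧ gapMap (min b c) (max b c) v ≠ c := by
      unfold gapMap
      split_ifs <;> omega
    obtain ⟨i, j, hij⟩ := hM.exists_eq (v := gapMap (min b c) (max b c) v) hv.1 hv.2.1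
    induction j using Fin.lastCases with
    | last =>
      fin_cases i
      · exact absurd (hij.symm.trans hcdef) hv.2.2.2
      · exact absurd (hij.symm.trans hbdef) hv.2.2.1
    | cast j =>
      rw [← (hM' i j).2] at hij
      exact ⟨i, j, (gapMap_strictMono hlt).injective hij⟩
  · ext i j
    induction j using Fin.lastCases with
    | last => fin_cases i <;> simp [hbdef, hcdef]
    | cast j => simp [(hM' i j).2]

theorem appendColumn_injective {n : ℕ} {M M' : Matrix (Fin 2) (Fin (n + 1)) ℕ} {b c b' c' : ℕ}
    (hbc : b ≠ c) (h : appendColumn M b c = appendColumn M' b' c') :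
    M = M' ∧ b = b' ∧ c = c' := by
  have hb : b = b' := by simpa using congrFun (congrFun h 1) (Fin.last _)
  have hc : c = c' := by simpa using congrFun (congrFun h 0) (Fin.last _)
  subst hb hc
  refine ⟨?_, rfl, rfl⟩
  ext i j
  have hlt : min b c < max b c := by omega
  apply (gapMap_strictMono hlt).injective
  simpa using congrFun (congrFun h i) j.castSucc

/-! ### Reductions as chains of inequalities -/

theorem lt_of_reduction_lt {p : Matrix (Fin 2) (Fin 2) ℕ} {i j i' j' : Fin 2}
    (h : reduction p i j < reduction p i' j') : p i j < p i' j' := by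
  by_contra! hle
  refine h.not_ge (Finset.card_le_card fun v hv => ?_)
  simp only [Finset.mem_filter, Finset.mem_univ, true_and] at hv ⊢
  exact hv.trans hle

/-- The entries of `B` are totally ordered without ties, so preserving its strict inequalities
already determines all comparisons in `p`, hence all ranks. -/
theorem reduction_eq_iff (B : Matrix (Fin 2) (Fin 2) ℕ) (hB : reduction B = B)
    (hinj : ∀ v w : Fin 2 × Fin 2, B v.1 v.2 = B w.1 w.2 → v = w) (p : Matrix (Fin 2) (Fin 2) ℕ) :
    reduction p = B ↔ ∀ i j i' j', B i j < B i' j' → p i j < p i' j' := by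
  constructor
  · rintro rfl i j i' j' h
    exact lt_of_reduction_lt h
  · intro h
    rw [← hB]
    have : ∀ i j i' j', p i j ≤ p i' j' ↔ B i j ≤ B i' j' := by
      intro i j i' j'
      constructor
      · intro hp
        by_contra! hlt
        exact (h _ _ _ _ hlt).not_ge hp
      · intro hp
        rcases hp.lt_or_eq with hlt | heq
        · exact (h _ _ _ _ hlt).le
        · obtain ⟨rfl, rfl⟩ := Prod.mk.inj (hinj (i, j) (i', j') heq)
          exact le_rfl
    ext i j
    simp only [reduction, this]

section reductions

variable (p q r u : ℕ)

theorem reduction_eq_A₂ : reduction !![p, q; r, u] = A₂ ↔ r < u ∧ u < p ∧ p < q := by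
  rw [reduction_eq_iff A₂ (by decide) (by decide)]
  simp [Fin.forall_fin_two, A₂]
  omega

theorem reduction_eq_A₃ : reduction !![p, q; r, u] = A₃ ↔ r < p ∧ p < u ∧ u < q := by
  rw [reduction_eq_iff A₃ (by decide) (by decide)]
  simp [Fin.forall_fin_two, A₃]
  omega

theorem reduction_eq_B₁ : reduction !![p, q; r, u] = B₁ ↔ r < q ∧ q < u ∧ u < p := by
  rw [reduction_eq_iff B₁ (by decide) (by decide)]
  simp [Fin.forall_fin_two, B₁]
  omega

theorem reduction_eq_B₂ : reduction !![p, q; r, u] = B₂ ↔ r < q ∧ q < p ∧ p < u := by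
  rw [reduction_eq_iff B₂ (by decide) (by decide)]
  simp [Fin.forall_fin_two, B₂]
  omega

theorem reduction_eq_B₃ : reduction !![p, q; r, u] = B₃ ↔ r < p ∧ p < q ∧ q < u := by
  rw [reduction_eq_iff B₃ (by decide) (by decide)]
  simp [Fin.forall_fin_two, B₃]
  omega

theorem reduction_eq_B₄ : reduction !![p, q; r, u] = B₄ ↔ q < r ∧ r < p ∧ p < u := by
  rw [reduction_eq_iff B₄ (by decide) (by decide)]
  simp [Fin.forall_fin_two, B₄]
  omega

theorem reduction_eq_B₅ : reduction !![p, q; r, u] = B₅ ↔ q < r ∧ r < u ∧ u < p := by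
  rw [reduction_eq_iff B₅ (by decide) (by decide)]
  simp [Fin.forall_fin_two, B₅]
  omega

theorem reduction_eq_B₆ : reduction !![p, q; r, u] = B₆ ↔ q < u ∧ u < r ∧ r < p := by
  rw [reduction_eq_iff B₆ (by decide) (by decide)]
  simp [Fin.forall_fin_two, B₆]
  omega

end reductions

/-! ### Two-rowed tableaux counted by their bottom right label -/

/-- `A₂` and `A₃` are the two standard fillings of a square with increasing rows and columns; they
differ only in the order of `p` and `u`. -/
theorem reduction_mem_A {p q r u : ℕ} (h : p ≠ u) :
    reduction !![p, q; r, u] ∈ ({A₂, A₃} : Set _) ↔ r < u ∧ u < q ∧ r < p ∧ p < q := by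
  rw [Set.mem_insert_iff, Set.mem_singleton_iff, reduction_eq_A₂, reduction_eq_A₃]
  omega

theorem gapMap_ne {b c v : ℕ} (_ : b ≠ c) : gapMap (min b c) (max b c) v ≠ b := by
  unfold gapMap
  split_ifs <;> omega

theorem finite_tableaux (n : ℕ) : (tableaux n).Finite :=
  (finite_isStandardPuzzle n).subset fun _ h => h.1

theorem appendColumn_mem_tableaux_iff {n : ℕ} {M : Matrix (Fin 2) (Fin (n + 1)) ℕ}
    (hM : IsStandardPuzzle n M) {b c : ℕ} (hbc : b ≠ c) (hb1 : 1 ≤ b) (hb : b ≤ 2 * n + 4)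
    (hc1 : 1 ≤ c) (hc : c ≤ 2 * n + 4) :
    appendColumn M b c ∈ tableaux (n + 1) ↔ M ∈ tableaux n ∧
      reduction !![gapMap (min b c) (max b c) (M 0 (Fin.last n)), c;
        gapMap (min b c) (max b c) (M 1 (Fin.last n)), b] ∈ ({A₂, A₃} : Set _) := by
  have hlt : min b c < max b c := by omega
  simp only [tableaux, Set.mem_ofPred_eq, isSupport_appendColumn _ _ hbc,
    isStandardPuzzle_appendColumn hM hbc hb1 hb hc1 hc, hM, true_and, appendColumn_last,
    reduction_mem_A (gapMap_ne hbc), (gapMap_strictMono hlt).lt_iff_lt]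
  simp
  grind

theorem apply_last_of_mem_tableaux {n : ℕ} {M : Matrix (Fin 2) (Fin (n + 1)) ℕ}
    (hM : M ∈ tableaux n) : M 0 (Fin.last n) = 2 * n + 2 := by
  induction n with
  | zero =>
    have h1 := hM.1.mem 0 (Fin.last 0)
    have h2 := hM.1.mem 1 (Fin.last 0)
    have h3 := hM.2.2
    omega
  | succ n ih =>
    obtain ⟨M', b, c, hM', hbc, hb, hc, rfl⟩ := hM.1.exists_appendColumn
    rw [appendColumn_mem_tableaux_iff hM' hbc hb.1 hb.2 hc.1 hc.2,
      reduction_mem_A (gapMap_ne hbc)] at hM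
    obtain ⟨hM, h⟩ := hM
    rw [ih hM] at h
    have : c = 2 * n + 4 := by
      unfold gapMap at h
      split_ifs at h <;> omega
    simp [this]
    ring

theorem appendColumn_mem_tableaux_iff' {n : ℕ} {M : Matrix (Fin 2) (Fin (n + 1)) ℕ}
    (hM : IsStandardPuzzle n M) {b c : ℕ} (hbc : b ≠ c) (hb1 : 1 ≤ b) (hb : b ≤ 2 * n + 4)
    (hc1 : 1 ≤ c) (hc : c ≤ 2 * n + 4) :
    appendColumn M b c ∈ tableaux (n + 1) ↔ M ∈ tableaux n ∧
      M 1 (Fin.last n) < b ∧ b ≤ 2 * n + 3 ∧ c = 2 * n + 4 := by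
  rw [appendColumn_mem_tableaux_iff hM hbc hb1 hb hc1 hc, reduction_mem_A (gapMap_ne hbc)]
  refine and_congr_right fun h => ?_
  have hlt := h.2.2
  rw [apply_last_of_mem_tableaux h] at hlt ⊢
  unfold gapMap
  split_ifs <;> omega

/-- Puzzles satisfying `R` are counted by the pairs of labels that can be appended to a tableau. -/
theorem ncard_eq_sum_card (n : ℕ) (R : Matrix (Fin 2) (Fin (n + 2)) ℕ → Prop)
    (D : ℕ → Finset (Σ _ : ℕ, ℕ))
    (hR : ∀ M, IsStandardPuzzle n M → ∀ b c, b ≠ c → (1 ≤ b ∧ b ≤ 2 * n + 4) →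
      (1 ≤ c ∧ c ≤ 2 * n + 4) →
      (R (appendColumn M b c) ↔ M ∈ tableaux n ∧ ⟨b, c⟩ ∈ D (M 1 (Fin.last n))))
    (hD : ∀ M ∈ tableaux n, ∀ b c, ⟨b, c⟩ ∈ D (M 1 (Fin.last n)) →
      b ≠ c ∧ (1 ≤ b ∧ b ≤ 2 * n + 4) ∧ (1 ≤ c ∧ c ≤ 2 * n + 4)) :
    {M | IsStandardPuzzle (n + 1) M ∧ R M}.ncard =
      ∑ x ∈ range (2 * n + 3),
        {M | M ∈ tableaux n ∧ M 1 (Fin.last n) = x}.ncard * (D x).card := by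
  classical
  set F := (finite_tableaux n).toFinset with hF
  have hmem : ∀ M, M ∈ F ↔ M ∈ tableaux n := by simp [hF]
  have heq : {M | IsStandardPuzzle (n + 1) M ∧ R M} =
      ((F.sigma fun M => D (M 1 (Fin.last n))).image
        fun q => appendColumn q.1 q.2.1 q.2.2 : Finset _) := by
    ext M
    simp only [Set.mem_ofPred_eq, Finset.coe_image, Set.mem_image, Finset.mem_coe,
      Finset.mem_sigma, hmem]
    constructor
    · rintro ⟨hM, h⟩
      obtain ⟨M', b, c, hM', hbc, hb, hc, rfl⟩ := hM.exists_appendColumn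
      rw [hR M' hM' b c hbc hb hc] at h
      exact ⟨⟨M', b, c⟩, h, rfl⟩
    · rintro ⟨⟨M', b, c⟩, ⟨h1, h2⟩, rfl⟩
      obtain ⟨hbc, hb, hc⟩ := hD M' h1 b c h2
      exact ⟨isStandardPuzzle_appendColumn h1.1 hbc hb.1 hb.2 hc.1 hc.2,
        (hR M' h1.1 b c hbc hb hc).2 ⟨h1, h2⟩⟩
  rw [heq, Set.ncard_coe_finset, Finset.card_image_of_injOn, Finset.card_sigma,
    ← Finset.sum_fiberwise_of_maps_to (s := F) (t := range (2 * n + 3))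
      (g := fun M => M 1 (Fin.last n))]
  · refine sum_congr rfl fun x _ => ?_
    have : {M | M ∈ tableaux n ∧ M 1 (Fin.last n) = x} =
        ((F.filter fun M => M 1 (Fin.last n) = x : Finset _) : Set _) := by
      ext M
      simp [hmem]
    rw [this, Set.ncard_coe_finset, ← smul_eq_mul, ← Finset.sum_const]
    refine sum_congr rfl fun M hM => ?_
    rw [(Finset.mem_filter.1 hM).2]
  · intro M hM
    have := ((hmem M).1 hM).1.mem 1 (Fin.last n)
    rw [mem_range]
    omega
  · rintro ⟨M, b, c⟩ hq ⟨M', b', c'⟩ hq' h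
    simp only [Finset.coe_sigma, Set.mem_sigma_iff, Finset.mem_coe, hmem] at hq
    obtain ⟨rfl, rfl, rfl⟩ := appendColumn_injective (hD M hq.1 b c hq.2).1 h
    rfl

theorem sum_range_eq_sum_t_mul {n : ℕ} {T : ℕ → ℕ}
    (hT : ∀ x, T x = if x ≤ n then 0 else t n (x - (n + 1))) (w : ℕ → ℕ) :
    ∑ x ∈ range (2 * n + 3), T x * w x = ∑ k ∈ range (n + 1), t n k * w (n + 1 + k) := by
  -- The last index `x = 2 * n + 2` corresponds to the zero entry `t n (n + 1)` and is dropped.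
  rw [show 2 * n + 3 = (n + 1) + (n + 2) by ring, sum_range_add, sum_range_succ _ (n + 1),
    sum_eq_zero, zero_add, hT (n + 1 + (n + 1)), if_neg (by omega),
    Nat.add_sub_cancel_left, t_eq_zero (n.lt_succ_self), zero_mul, add_zero]
  · refine sum_congr rfl fun k _ => ?_
    rw [hT, if_neg (by omega), Nat.add_sub_cancel_left]
  · intro x hx
    rw [mem_range] at hx
    rw [hT, if_pos (by omega), zero_mul]

theorem ncard_tableaux_zero (x : ℕ) :
    {M | M ∈ tableaux 0 ∧ M 1 (Fin.last 0) = x}.ncard = if x = 1 then 1 else 0 := by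
  have key : ∀ M ∈ tableaux 0, M = !![2; 1] := by
    intro M hM
    have h1 := hM.1.mem 0 (Fin.last 0)
    have h2 := hM.1.mem 1 (Fin.last 0)
    have h3 := hM.2.2
    ext i j
    fin_cases i <;> fin_cases j <;> simp at * <;> omega
  have hmem : !![2; 1] ∈ tableaux 0 := by
    refine ⟨isStandardPuzzle_of (fun i j => ?_) fun v h1 h2 => ?_, fun k => k.elim0, by simp⟩
    · fin_cases i <;> fin_cases j <;> simp
    · obtain rfl | rfl : v = 1 ∨ v = 2 := by omega
      · exact ⟨1, 0, rfl⟩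
      · exact ⟨0, 0, rfl⟩
  split_ifs with hx
  · rw [Set.ncard_eq_one]
    refine ⟨!![2; 1], Set.eq_singleton_iff_unique_mem.2 ⟨⟨hmem, by simp [hx]⟩, ?_⟩⟩
    exact fun M hM => key M hM.1
  · rw [Set.ncard_eq_zero (((finite_tableaux 0).subset fun _ h => h.1))]
    refine Set.eq_empty_of_forall_notMem fun M hM => hx ?_
    rw [← hM.2, key M hM.1]
    simp

/-- A tableau with bottom right label `y` extends uniquely to one with bottom right label `x` when
`y < x ≤ 2 * n + 3`, so the counts obey the partial-sum recursion of `t`. -/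
theorem ncard_tableaux (n x : ℕ) :
    {M | M ∈ tableaux n ∧ M 1 (Fin.last n) = x}.ncard =
      if x ≤ n then 0 else t n (x - (n + 1)) := by
  induction n generalizing x with
  | zero =>
    rw [ncard_tableaux_zero, t]
    split_ifs <;> omega
  | succ n ih =>
    have h := ncard_eq_sum_card n (fun M => M ∈ tableaux (n + 1) ∧ M 1 (Fin.last (n + 1)) = x)
      (fun y => if y < x ∧ x ≤ 2 * n + 3 then {⟨x, 2 * n + 4⟩} else ∅)
      (fun M hM b c hbc hb hc => by
        rw [appendColumn_mem_tableaux_iff' hM hbc hb.1 hb.2 hc.1 hc.2, appendColumn_last]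
        split_ifs <;> simp <;> grind)
      (fun M hM b c h => by
        have := hM.1.mem 1 (Fin.last n)
        split_ifs at h
        · simp only [mem_singleton, Sigma.mk.injEq, heq_eq_eq] at h
          omega
        · simp at h)
    have hset : {M | M ∈ tableaux (n + 1) ∧ M 1 (Fin.last (n + 1)) = x} =
        {M | IsStandardPuzzle (n + 1) M ∧ M ∈ tableaux (n + 1) ∧ M 1 (Fin.last (n + 1)) = x} :=
      Set.ext fun M => ⟨fun h => ⟨h.1.1, h⟩, fun h => h.2⟩
    rw [hset, h, sum_range_eq_sum_t_mul ih]
    split_ifs with hx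
    · refine sum_eq_zero fun k _ => ?_
      rw [if_neg (by omega)]
      simp
    · obtain ⟨j, rfl⟩ : ∃ j, x = n + 2 + j := ⟨x - (n + 2), by omega⟩
      rw [show n + 2 + j - (n + 1 + 1) = j by omega]
      by_cases hj : j ≤ n + 1
      · rw [t_succ_eq_sum hj]
        -- For `y = n + 1 + k` and `x = n + 2 + j`, the condition `y < x` reads `k ≤ j`.
        have hext : ∀ k ∈ range (n + 1), t n k * (if n + 1 + k < n + 2 + j ∧ n + 2 + j ≤ 2 * n + 3
            then ({⟨n + 2 + j, 2 * n + 4⟩} : Finset (Σ _ : ℕ, ℕ)) else ∅).card =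
            if k < j + 1 then t n k else 0 := by
          intro k _
          by_cases hk : k < j + 1
          · rw [if_pos (by omega), if_pos hk]
            simp
          · rw [if_neg (by omega), if_neg hk]
            simp
        rw [sum_congr rfl hext, ← sum_filter]
        -- For `j = n + 1` the recursion has one extra term, beyond the diagonal, which is zero.
        refine sum_subset (fun k hk => ?_) fun k hk hk' => t_eq_zero ?_
        · simp at hk ⊢
          omega
        · simp at hk hk'
          omega
      · rw [t_eq_zero (by omega)]
        refine sum_eq_zero fun k _ => ?_
        rw [if_neg (by omega)]
        simp

/-! ### Reduction to the choice of the last column -/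

/-- Every column but the last is the left column of a piece, hence increasing; once the last one is
too, no piece can have the decreasing right column of `B`. -/
theorem isSupport_of_isSupport_union {n : ℕ} {M : Matrix (Fin 2) (Fin (n + 1)) ℕ}
    {B : Matrix (Fin 2) (Fin 2) ℕ} (hl : B 1 0 < B 0 0) (hr : B 0 1 < B 1 1)
    (h : IsSupport ({A₂, A₃} ∪ {B}) M) (hlast : M 1 (Fin.last n) < M 0 (Fin.last n)) :
    IsSupport {A₂, A₃} M := by
  have hcol : ∀ j, M 1 j < M 0 j := by
    intro j
    induction j using Fin.lastCases with
    | last => exact hlast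
    | cast k =>
      have : reduction (pieceAt M k) 1 0 < reduction (pieceAt M k) 0 0 := by
        rcases h k with (h | h) | h
        · rw [h]; decide
        · rw [h]; decide
        · rw [h]; exact hl
      exact lt_of_reduction_lt this
  intro k
  refine (h k).resolve_right fun hk => ?_
  have : reduction (pieceAt M k) 0 1 < reduction (pieceAt M k) 1 1 := by
    rw [hk]; exact hr
  exact (hcol k.succ).not_gt (lt_of_reduction_lt this)

/-- The weight splits as `(m - k + 1) + 1`, giving two entries of the triangle that add up to a
near-diagonal one. It is the number of tableau columns that can be appended. -/
theorem sum_t_mul_eq_catalan (m : ℕ) :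
    ∑ k ∈ range (m + 1), t m k * (m + 2 - k) = catalan (m + 2) := by
  have h0 := sum_choose_mul_t m 0
  have h1 := sum_choose_mul_t m 1
  rw [← t_diag_eq_catalan, t_succ_succ (by omega), ← h1, t_diag, ← h0, ← sum_add_distrib]
  refine sum_congr rfl fun k hk => ?_
  rw [mem_range] at hk
  rw [Nat.choose_zero_right, Nat.choose_one_right, show m + 2 - k = m - k + 1 + 1 by omega]
  ring

/-- Removing the last column leaves a tableau with top right label `2 * m + 2`. Thus `E x` has to
list only the columns `(b, c)` completing the bottom right label `x` to a last piece of type `B`;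
those of type `A₂`, `A₃` give the Catalan term. -/
theorem s_succ_eq (m : ℕ) {B : Matrix (Fin 2) (Fin 2) ℕ} (hl : B 1 0 < B 0 0)
    (hr : B 0 1 < B 1 1) (E : ℕ → Finset (Σ _ : ℕ, ℕ))
    (hE : ∀ x b c, 1 ≤ x → x < 2 * m + 2 → (⟨b, c⟩ ∈ E x ↔ b ≠ c ∧ (1 ≤ b ∧ b ≤ 2 * m + 4) ∧
      (1 ≤ c ∧ c ≤ 2 * m + 4) ∧ reduction !![gapMap (min b c) (max b c) (2 * m + 2), c;
        gapMap (min b c) (max b c) x, b] = B)) :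
    s (m + 1) ({A₂, A₃} ∪ {B}) =
      ∑ k ∈ range (m + 1), (E (m + 1 + k)).card * t m k + catalan (m + 2) := by
  classical
  have hA : ∀ x b c, 1 ≤ x → x < 2 * m + 2 →
      ((⟨b, c⟩ : Σ _ : ℕ, ℕ) ∈ (Ioc x (2 * m + 3)).sigma (fun _ => {2 * m + 4}) ↔
      b ≠ c ∧ (1 ≤ b ∧ b ≤ 2 * m + 4) ∧
      (1 ≤ c ∧ c ≤ 2 * m + 4) ∧ reduction !![gapMap (min b c) (max b c) (2 * m + 2), c;
        gapMap (min b c) (max b c) x, b] ∈ ({A₂, A₃} : Set _)) := by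
    intro x b c h1 h2
    rw [mem_sigma, mem_Ioc, mem_singleton]
    by_cases hbc : b = c
    · simp only [hbc]
      omega
    rw [reduction_mem_A (gapMap_ne hbc)]
    unfold gapMap
    split_ifs <;> grind
  have hBA : B ∉ ({A₂, A₃} : Set _) := by
    rintro (rfl | rfl) <;> revert hr <;> decide
  have hx : ∀ M ∈ tableaux m, 1 ≤ M 1 (Fin.last m) ∧ M 1 (Fin.last m) < 2 * m + 2 := by
    intro M hM
    have h1 := (hM.1.mem 1 (Fin.last m)).1
    have h2 := hM.2.2
    rw [apply_last_of_mem_tableaux hM] at h2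
    exact ⟨h1, h2⟩
  have h := ncard_eq_sum_card m (fun M => IsSupport ({A₂, A₃} ∪ {B}) M)
    (fun x => (Ioc x (2 * m + 3)).sigma (fun _ => {2 * m + 4}) ∪ E x)
    (fun M hM b c hbc hb hc => by
      have hlt : min b c < max b c := by omega
      rw [isSupport_appendColumn _ _ hbc]
      constructor
      · rintro ⟨h1, h2⟩
        -- The left column of the new piece is the last column of `M`, so `M` ends in an increasing
        -- column.
        have hred : ∀ p : Matrix (Fin 2) (Fin 2) ℕ, reduction p ∈ ({A₂, A₃} ∪ {B} : Set _) →
            p 1 0 < p 0 0 := by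
          intro p hp
          apply lt_of_reduction_lt
          rcases hp with (h | h) | h
          · rw [h]; decide
          · rw [h]; decide
          · rw [h]; exact hl
        have hlast : M 1 (Fin.last m) < M 0 (Fin.last m) :=
          (gapMap_strictMono hlt).lt_iff_lt.1 (hred _ h2)
        have hT : M ∈ tableaux m := ⟨hM, isSupport_of_isSupport_union hl hr h1 hlast, hlast⟩
        refine ⟨hT, ?_⟩
        rw [apply_last_of_mem_tableaux hT] at h2
        rw [mem_union, hA _ _ _ (hx M hT).1 (hx M hT).2, hE _ _ _ (hx M hT).1 (hx M hT).2]
        exact h2.imp (fun h => ⟨hbc, hb, hc, h⟩) (fun h => ⟨hbc, hb, hc, h⟩)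
      · rintro ⟨hT, h⟩
        rw [mem_union, hA _ _ _ (hx M hT).1 (hx M hT).2, hE _ _ _ (hx M hT).1 (hx M hT).2] at h
        refine ⟨fun k => Or.inl (hT.2.1 k), ?_⟩
        rw [apply_last_of_mem_tableaux hT]
        exact h.imp (fun h => h.2.2.2) (fun h => h.2.2.2))
    (fun M hT b c h => by
      rw [mem_union, hA _ _ _ (hx M hT).1 (hx M hT).2, hE _ _ _ (hx M hT).1 (hx M hT).2] at h
      rcases h with h | h
      · exact ⟨h.1, h.2.1, h.2.2.1⟩
      · exact ⟨h.1, h.2.1, h.2.2.1⟩)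
  have hs : s (m + 1) ({A₂, A₃} ∪ {B}) =
      {M | IsStandardPuzzle (m + 1) M ∧ IsSupport ({A₂, A₃} ∪ {B}) M}.ncard := rfl
  rw [hs, h, sum_range_eq_sum_t_mul (ncard_tableaux m), ← sum_t_mul_eq_catalan, ← sum_add_distrib]
  refine sum_congr rfl fun k hk => ?_
  rw [mem_range] at hk
  rw [card_union_of_disjoint, card_sigma]
  · simp only [card_singleton, sum_const, Nat.card_Ioc, smul_eq_mul, mul_one]
    rw [show 2 * m + 3 - (m + 1 + k) = m + 2 - k by omega]
    ring
  · rw [Finset.disjoint_left]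
    rintro ⟨b, c⟩ h1 h2
    rw [hA _ _ _ (by omega) (by omega)] at h1
    rw [hE _ _ _ (by omega) (by omega)] at h2
    exact hBA (h2.2.2.2 ▸ h1.2.2.2)

/-! ### The admissible last columns for each of the six pieces -/

theorem card_sigma_Ioo (x d : ℕ) :
    ((Ioc x (x + d)).sigma fun b => Ioo x b).card = d.choose 2 := by
  rw [card_sigma]
  induction d with
  | zero => simp
  | succ d ih =>
    rw [← add_assoc, sum_Ioc_succ_top (by omega), ih, Nat.card_Ioo, Nat.choose_succ_succ' d 1,
      Nat.choose_one_right, one_add_one_eq_two]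
    omega

theorem s_B₁ (m : ℕ) :
    s (m + 1) ({A₂, A₃} ∪ {B₁}) = t (m + 3) m + catalan (m + 2) := by
  -- The piece requires `x < c < b` with `b` below the old maximum, which is shifted to `2 * m + 4`.
  rw [s_succ_eq m (by decide) (by decide) (fun x => (Ioc x (2 * m + 3)).sigma fun b => Ioo x b),
    ← sum_choose_mul_t]
  · congr 1
    refine sum_congr rfl fun k hk => ?_
    rw [mem_range] at hk
    rw [show 2 * m + 3 = (m + 1 + k) + (m - k + 2) by omega, card_sigma_Ioo]
  · intro x b c h1 h2
    rw [mem_sigma, mem_Ioc, mem_Ioo, reduction_eq_B₁]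
    unfold gapMap
    split_ifs <;> grind

theorem s_B₂ (m : ℕ) :
    s (m + 1) ({A₂, A₃} ∪ {B₂}) = t (m + 2) m + catalan (m + 2) := by
  rw [s_succ_eq m (by decide) (by decide)
    -- Here `b` is the new maximum, and `c` lies below the old one, which becomes `2 * m + 3`.
    (fun x => ({2 * m + 4} : Finset ℕ).sigma fun _ => Ioc x (2 * m + 2)), ← sum_choose_mul_t]
  · congr 1
    refine sum_congr rfl fun k hk => ?_
    rw [mem_range] at hk
    rw [card_sigma, sum_singleton, Nat.card_Ioc, Nat.choose_one_right]
    congr 1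
    omega
  · intro x b c h1 h2
    rw [mem_sigma, mem_Ioc, mem_singleton, reduction_eq_B₂]
    unfold gapMap
    split_ifs <;> grind

theorem s_B₃ (m : ℕ) :
    s (m + 1) ({A₂, A₃} ∪ {B₃}) = t (m + 1) m + catalan (m + 2) := by
  rw [s_succ_eq m (by decide) (by decide)
    (fun _ => ({2 * m + 4} : Finset ℕ).sigma fun _ => {2 * m + 3}), t_succ_eq_sum (by omega)]
  · congr 1
    refine sum_congr rfl fun k hk => ?_
    simp
  · intro x b c h1 h2
    rw [mem_sigma, mem_singleton, mem_singleton, reduction_eq_B₃]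
    unfold gapMap
    split_ifs <;> grind

theorem s_B₄ (m : ℕ) :
    s (m + 1) ({A₂, A₃} ∪ {B₄}) =
      ∑ k ∈ range (m + 1), (m + 1 + k) * t m k + catalan (m + 2) := by
  rw [s_succ_eq m (by decide) (by decide)
    (fun x => ({2 * m + 4} : Finset ℕ).sigma fun _ => Icc 1 x)]
  · simp
  · intro x b c h1 h2
    rw [mem_sigma, mem_Icc, mem_singleton, reduction_eq_B₄]
    unfold gapMap
    split_ifs <;> grind

theorem s_B₅ (m : ℕ) :
    s (m + 1) ({A₂, A₃} ∪ {B₅}) =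
      ∑ k ∈ range (m + 1), (m + 1 + k) * (m - k + 1) * t m k + catalan (m + 2) := by
  rw [s_succ_eq m (by decide) (by decide)
    -- The smaller label `c ≤ x` shifts `x` to `x + 1`, so `b` starts at `x + 2`.
    (fun x => (Icc (x + 2) (2 * m + 3)).sigma fun _ => Icc 1 x)]
  · congr 1
    refine sum_congr rfl fun k hk => ?_
    rw [mem_range] at hk
    rw [card_sigma, sum_const, Nat.card_Icc, Nat.card_Icc, smul_eq_mul, mul_comm (m + 1 + k)]
    congr 2
    omega
  · intro x b c h1 h2
    rw [mem_sigma, mem_Icc, mem_Icc, reduction_eq_B₅]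
    unfold gapMap
    split_ifs <;> grind

theorem s_B₆ (m : ℕ) :
    s (m + 1) ({A₂, A₃} ∪ {B₆}) =
      ∑ k ∈ range (m + 1), (m + 2 + k).choose 2 * t m k + catalan (m + 2) := by
  rw [s_succ_eq m (by decide) (by decide)
    -- Both new labels lie below `x`, which is shifted to `x + 2`; hence `c < b ≤ x + 1`.
    (fun x => (Ioc 0 (0 + (x + 1))).sigma fun b => Ioo 0 b)]
  · congr 1
    refine sum_congr rfl fun k hk => ?_
    rw [card_sigma_Ioo]
    congr 2
    omega
  · intro x b c h1 h2
    rw [mem_sigma, mem_Ioc, mem_Ioo, reduction_eq_B₆]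
    unfold gapMap
    split_ifs <;> grind

/-! ### Evaluation of the weighted sums and closed forms -/

/-- The weight is `2 * (m + 1) - (m - k + 1)`. The next two sums are likewise expanded in `(m - k +
r).choose r` with `r ≤ 2`. -/
theorem sum_mul_t_B₄ (m : ℕ) :
    ((∑ k ∈ range (m + 1), (m + 1 + k) * t m k : ℕ) : ℚ) =
      2 * (m + 1) * t (m + 1) m - t (m + 2) m := by
  rw [show t (m + 1) m = _ from (sum_choose_mul_t m 0).symm,
    show t (m + 2) m = _ from (sum_choose_mul_t m 1).symm]
  push_cast
  rw [mul_sum, ← sum_sub_distrib]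
  refine sum_congr rfl fun k hk => ?_
  rw [mem_range] at hk
  rw [Nat.choose_zero_right, Nat.choose_one_right]
  push_cast [show k ≤ m by omega]
  ring

theorem sum_mul_t_B₅ (m : ℕ) :
    ((∑ k ∈ range (m + 1), (m + 1 + k) * (m - k + 1) * t m k : ℕ) : ℚ) =
      (2 * m + 3) * t (m + 2) m - 2 * t (m + 3) m := by
  rw [show t (m + 2) m = _ from (sum_choose_mul_t m 1).symm,
    show t (m + 3) m = _ from (sum_choose_mul_t m 2).symm]
  push_cast
  rw [mul_sum, mul_sum, ← sum_sub_distrib]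
  refine sum_congr rfl fun k hk => ?_
  rw [mem_range] at hk
  rw [Nat.choose_one_right, Nat.cast_choose_two]
  push_cast [show k ≤ m by omega]
  ring

theorem sum_mul_t_B₆ (m : ℕ) :
    ((∑ k ∈ range (m + 1), (m + 2 + k).choose 2 * t m k : ℕ) : ℚ) =
      (m + 1) * (2 * m + 3) * t (m + 1) m - (2 * m + 3) * t (m + 2) m + t (m + 3) m := by
  rw [show t (m + 1) m = _ from (sum_choose_mul_t m 0).symm,
    show t (m + 2) m = _ from (sum_choose_mul_t m 1).symm,
    show t (m + 3) m = _ from (sum_choose_mul_t m 2).symm]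
  push_cast
  rw [mul_sum, mul_sum, ← sum_sub_distrib, ← sum_add_distrib]
  refine sum_congr rfl fun k hk => ?_
  rw [mem_range] at hk
  rw [Nat.choose_zero_right, Nat.choose_one_right, Nat.cast_choose_two, Nat.cast_choose_two]
  push_cast [show k ≤ m by omega]
  ring

/-- This and the next three formulas express every ingredient as a rational function of `m` times
one central binomial coefficient, so that the closed forms become rational identities. -/
theorem t_succ_cast (m : ℕ) :
    (t (m + 1) m : ℚ) = 2 * (2 * m + 1) / ((m + 1) * (m + 2)) * m.centralBinom := by
  rw [t_add_eq m 1, Nat.centralBinom, two_mul m, Nat.cast_add_choose ℚ]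
  simp only [Nat.factorial_succ]
  push_cast
  field_simp
  ring

theorem t_add_two_cast (m : ℕ) :
    (t (m + 2) m : ℚ) =
      6 * (2 * m + 1) / ((m + 2) * (m + 3)) * m.centralBinom := by
  rw [t_add_eq m 2, Nat.centralBinom, two_mul m, Nat.cast_add_choose ℚ]
  simp only [Nat.factorial_succ]
  push_cast
  field_simp
  ring

theorem t_add_three_cast (m : ℕ) :
    (t (m + 3) m : ℚ) =
      8 * (2 * m + 1) * (2 * m + 3) / ((m + 2) * (m + 3) * (m + 4)) * m.centralBinom := by
  rw [t_add_eq m 3, Nat.centralBinom, two_mul m, Nat.cast_add_choose ℚ]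
  simp only [Nat.factorial_succ]
  push_cast
  field_simp
  ring

theorem catalan_add_two_cast (m : ℕ) :
    (catalan (m + 2) : ℚ) =
      4 * (2 * m + 1) * (2 * m + 3) / ((m + 1) * (m + 2) * (m + 3)) * m.centralBinom := by
  rw [← t_diag_eq_catalan, t_add_eq (m + 1) 1, Nat.centralBinom, two_mul m,
    Nat.cast_add_choose ℚ, show 2 * (m + 1) + 1 = m + m + 3 by ring]
  simp only [Nat.factorial_succ]
  push_cast
  field_simp
  ring

theorem cast_choose_eq (a b c : ℕ) (h : a = b + c) :
    (a.choose b : ℚ) = a.factorial / (b.factorial * c.factorial) := by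
  rw [h, Nat.cast_add_choose]

theorem sum_Icc_one_eq_sum_range (N : ℕ) (g : ℕ → ℕ) :
    ∑ k ∈ Icc 1 N, g k = ∑ j ∈ range N, g (j + 1) := by
  induction N with
  | zero => simp
  | succ N ih => rw [sum_Icc_succ_top (by omega), ih, sum_range_succ]

theorem s_B₄_eq_choose (m : ℕ) :
    s (m + 1) ({A₂, A₃} ∪ {B₄}) = (2 * (m + 1) + 1).choose (m + 1) := by
  rw [s_B₄, ← Nat.cast_inj (R := ℚ), Nat.cast_add, sum_mul_t_B₄, t_succ_cast, t_add_two_cast,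
    catalan_add_two_cast, cast_choose_eq _ (m + 1) (m + 2) (by ring), Nat.centralBinom,
    cast_choose_eq (2 * m) m m (by ring), show 2 * (m + 1) + 1 = 2 * m + 3 by ring]
  simp only [Nat.factorial_succ]
  push_cast
  field_simp
  ring

theorem s_B₁_closed (m : ℕ) :
    (s (m + 1) ({A₂, A₃} ∪ {B₁}) : ℚ) =
      3 / ((m + 1 : ℕ) + 3) * (2 * (m + 1) + 2).choose (m + 1) := by
  rw [s_B₁, Nat.cast_add, t_add_three_cast, catalan_add_two_cast,
    cast_choose_eq _ (m + 1) (m + 3) (by ring), Nat.centralBinom,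
    cast_choose_eq (2 * m) m m (by ring), show 2 * (m + 1) + 2 = 2 * m + 4 by ring]
  simp only [Nat.factorial_succ]
  push_cast
  field_simp
  ring

theorem s_B₂_closed (m : ℕ) :
    (s (m + 1) ({A₂, A₃} ∪ {B₂}) : ℚ) =
      (7 * (m + 1 : ℕ) + 2) / ((m + 1 : ℕ) ^ 2 + 2 * (m + 1 : ℕ)) *
        (2 * (m + 1)).choose (m + 1 + 1) := by
  rw [s_B₂, Nat.cast_add, t_add_two_cast, catalan_add_two_cast,
    cast_choose_eq _ (m + 1 + 1) m (by ring), Nat.centralBinom,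
    cast_choose_eq (2 * m) m m (by ring), show 2 * (m + 1) = 2 * m + 2 by ring]
  simp only [Nat.factorial_succ]
  push_cast
  -- Factoring the denominator exposes factors that are visibly nonzero.
  rw [show ((m : ℚ) + 1) ^ 2 + 2 * (m + 1) = (m + 1) * (m + 3) by ring]
  field_simp
  ring

theorem s_B₅_closed (m : ℕ) :
    (s (m + 1) ({A₂, A₃} ∪ {B₅}) : ℚ) =
      8 * (m + 1 : ℕ) * (2 * (m + 1 : ℕ) + 1) / (((m + 1 : ℕ) + 2) * ((m + 1 : ℕ) + 3)) *
          (2 * (m + 1) - 1).choose (m + 1)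
        + 2 / ((m + 1 : ℕ) + 2) * (2 * (m + 1) + 2).choose (m + 1 + 1)
        - (2 * (m + 1) + 1).choose (m + 1) := by
  rw [s_B₅, Nat.cast_add, sum_mul_t_B₅, t_add_two_cast, t_add_three_cast, catalan_add_two_cast,
    cast_choose_eq _ (m + 1) m (by omega), cast_choose_eq _ (m + 1 + 1) (m + 2) (by ring),
    cast_choose_eq _ (m + 1) (m + 2) (by ring), Nat.centralBinom,
    cast_choose_eq (2 * m) m m (by ring), show 2 * (m + 1) - 1 = 2 * m + 1 by omega,
    show 2 * (m + 1) + 2 = 2 * m + 4 by ring, show 2 * (m + 1) + 1 = 2 * m + 3 by ring]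
  simp only [Nat.factorial_succ]
  push_cast
  field_simp
  ring

theorem s_B₆_closed (m : ℕ) :
    (s (m + 1) ({A₂, A₃} ∪ {B₆}) : ℚ) =
      3 * (2 * (m + 1) - 1).choose (m + 1) * (2 * (m + 1) + 2).choose 3 /
          (((m + 1 : ℕ) + 2) * ((m + 1 : ℕ) + 3))
        + (2 * (m + 1) + 2).choose (m + 1 + 1) / ((m + 1 : ℕ) + 2) := by
  rw [s_B₆, Nat.cast_add, sum_mul_t_B₆, t_succ_cast, t_add_two_cast, t_add_three_cast,
    catalan_add_two_cast,
    cast_choose_eq _ (m + 1) m (by omega), cast_choose_eq _ (m + 1 + 1) (m + 2) (by ring),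
    cast_choose_eq _ 3 (2 * m + 1) (by ring), Nat.centralBinom,
    cast_choose_eq (2 * m) m m (by ring), show 2 * (m + 1) - 1 = 2 * m + 1 by omega,
    show 2 * (m + 1) + 2 = 2 * m + 4 by ring]
  simp only [Nat.factorial_succ, Nat.factorial_zero]
  push_cast
  field_simp
  ring

/-- Raising the factor `m - k + 1` to `m - k + 2` adds exactly the weighted sum for `B₄`, which is
`(2 * (m + 1) + 1).choose (m + 1)` minus a Catalan number. -/
theorem s_B₅_eq_sum (m : ℕ) :
    (s (m + 1) ({A₂, A₃} ∪ {B₅}) : ℤ) =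
      ∑ k ∈ range (m + 1), (((m + 1 + k) * (m - k + 2) * t m k : ℕ) : ℤ)
        - (2 * (m + 1) + 1).choose (m + 1) + 2 * catalan (m + 2) := by
  rw [← s_B₄_eq_choose, s_B₄, s_B₅]
  have : ∑ k ∈ range (m + 1), (m + 1 + k) * (m - k + 2) * t m k =
      ∑ k ∈ range (m + 1), (m + 1 + k) * (m - k + 1) * t m k +
        ∑ k ∈ range (m + 1), (m + 1 + k) * t m k := by
    rw [← sum_add_distrib]
    exact sum_congr rfl fun k _ => by ring
  rw [← Nat.cast_sum, this]
  push_cast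
  ring

end StandardPuzzle

open StandardPuzzle in
theorem mainTheorem11 (n : ℕ) (hn : 1 ≤ n) :
    -- the closed forms
    ((s n ({A₂, A₃} ∪ {B₁}) : ℚ) = 3 / (n + 3) * (2 * n + 2).choose n ∧
     (s n ({A₂, A₃} ∪ {B₂}) : ℚ) = (7 * n + 2) / (n ^ 2 + 2 * n) * (2 * n).choose (n + 1) ∧
     s n ({A₂, A₃} ∪ {B₃}) = catalan (n + 1) + catalan n ∧
     s n ({A₂, A₃} ∪ {B₄}) = (2 * n + 1).choose n ∧
     (s n ({A₂, A₃} ∪ {B₅}) : ℚ) =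
        8 * n * (2 * n + 1) / ((n + 2) * (n + 3)) * (2 * n - 1).choose n
          + 2 / (n + 2) * (2 * n + 2).choose (n + 1) - (2 * n + 1).choose n ∧
     (s n ({A₂, A₃} ∪ {B₆}) : ℚ) =
        3 * (2 * n - 1).choose n * (2 * n + 2).choose 3 / ((n + 2) * (n + 3))
          + (2 * n + 2).choose (n + 1) / (n + 2)) ∧
    -- the sums against Catalan's triangle
    ((2 ≤ n → s n ({A₂, A₃} ∪ {B₁}) =
        ∑ k ∈ Finset.Icc 1 (n - 1), (n - k + 3).choose 3 * t (n - 2) (k - 1)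
          + catalan (n + 1)) ∧
     (2 ≤ n → s n ({A₂, A₃} ∪ {B₂}) =
        ∑ k ∈ Finset.Icc 1 (n - 1), (n - k + 2).choose 2 * t (n - 2) (k - 1)
          + catalan (n + 1)) ∧
     s n ({A₂, A₃} ∪ {B₄}) =
        ∑ k ∈ Finset.Icc 1 n, (n + k - 1) * t (n - 1) (k - 1) + catalan (n + 1) ∧
     (s n ({A₂, A₃} ∪ {B₅}) : ℤ) =
        ∑ k ∈ Finset.Icc 1 n, (((n + k - 1) * (n - k + 2) * t (n - 1) (k - 1) : ℕ) : ℤ)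
          - (2 * n + 1).choose n + 2 * catalan (n + 1) ∧
     s n ({A₂, A₃} ∪ {B₆}) =
        ∑ k ∈ Finset.Icc 1 n, (n + k).choose 2 * t (n - 1) (k - 1) + catalan (n + 1)) := by
  obtain ⟨m, rfl⟩ : ∃ m, n = m + 1 := ⟨n - 1, by omega⟩
  refine ⟨⟨s_B₁_closed m, s_B₂_closed m, ?_, s_B₄_eq_choose m, s_B₅_closed m, s_B₆_closed m⟩,
    fun h => ?_, fun h => ?_, ?_, ?_, ?_⟩
  · rw [s_B₃, t_diag_eq_catalan, add_comm]
  · obtain ⟨l, rfl⟩ : ∃ l, m = l + 1 := ⟨m - 1, by omega⟩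
    rw [s_B₁, sum_Icc_one_eq_sum_range]
    congr 1
    refine (sum_choose_mul_t_pred l 2).symm.trans (Finset.sum_congr rfl fun k hk => ?_)
    rw [Finset.mem_range] at hk
    congr 2
    omega
  · obtain ⟨l, rfl⟩ : ∃ l, m = l + 1 := ⟨m - 1, by omega⟩
    rw [s_B₂, sum_Icc_one_eq_sum_range]
    congr 1
    refine (sum_choose_mul_t_pred l 1).symm.trans (Finset.sum_congr rfl fun k hk => ?_)
    rw [Finset.mem_range] at hk
    congr 2
    omega
  · rw [s_B₄, sum_Icc_one_eq_sum_range]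
    rfl
  · rw [s_B₅_eq_sum, ← Nat.cast_sum, ← Nat.cast_sum, sum_Icc_one_eq_sum_range]
    congr 3
    refine Finset.sum_congr rfl fun k hk => ?_
    rw [Nat.add_sub_add_right]
    rfl
  · rw [s_B₆, sum_Icc_one_eq_sum_range]
    congr 1
    refine Finset.sum_congr rfl fun k _ => ?_
    congr 2
    omega
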